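/- Let $M$ be a Garside monoid. This means: $M$ is cancellative; $M$ is atomic (it is generated by its atoms, i.e. the elements $x\neq 1$ such that $x=yz$ implies $y=1$ or $z=1$, and for each $x\in M$ the lengths of the decompositions of $x$ into products of atoms are bounded); any two elements of $M$ have a left lcm, a right lcm, a left gcd and a right gcd; and $M$ contains a Garside element, i.e. an element whose left divisors and right divisors coincide, are finite in number, and generate $M$. Let $G$ be the group of fractions of $M$: $M$ embeds in $G$, and every element of $G$ has the form $x^{-1}y$ with $x,y\in M$. Then $G$ is biautomatic. More precisely, write $x\wedge y$ for the left gcd, $x\vee y$ for the right lcm, and $x\backslash y$ for the element with $x(x\backslash y)=x\vee y$. Let $S$ be the set of simple elements of $M$, i.e. the closure of the set of atoms under $\backslash$ and $\vee$. Then $S$ has a right lcm $\Delta$; put $x^*=x\backslash\Delta$ for $x\in S$. Let $L$ be the set of left normal forms (mixed canonical forms), i.e. of the words $$x_p^{-1}\cdots x_1^{-1}\,y_1\cdots y_q\qquad(p,q\ge 0)$$ over the alphabet $S\cup S^{-1}$ with $x_1,\dots,x_p,y_1,\dots,y_q\in S\setminus\{1\}$, $x_k^*\wedge x_{k+1}=1$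 for $1\le k<p$, $y_k^*\wedge y_{k+1}=1$ for $1\le k<q$, and $x_1\wedge y_1=1$ if $p,q\ge1$. Then: 1. Every element of $G$ is represented by exactly one word of $L$. 2. $L$ is the language of a biautomatic structure on $G$: the alphabet is finite and closed under inversion, $L$ is regular and represents every element of $G$, and, for each $g\in\{1\}\cup S\cup S^{-1}$, the sets of pairs $(u,v)\in L\times L$ with $\bar v=\bar u g$ and with $\bar v=g\bar u$ are regular languages of pairs (the two words being read synchronously, the shorter one padded at its end), where $\bar u$ denotes the element of $G$ represented by $u$. 3. $L$ has the $2$-fellow-traveller property on both sides. Let $d$ be the word distance of $G$ for the generators $S\cup S^{-1}$, and let $u(t)$ be the element represented by the prefix of length $t$ of $u$ (by $u$ itself, if $t$ exceeds the length of $u$). For all $u,v\in L$, all $g\in\{1\}\cup S\cup S^{-1}$ and all integers $t\ge0$: if $\bar v=\bar u g$, then $d(u(t),v(t))\le2$; and if $\bar v=g\bar u$, then $d(g\,u(t),v(t))\le2$. -/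

import Mathlib

namespace Garside

section Divisibility

variable {M : Type*} [Monoid M]

/-- `x` is a left divisor of `y` (and `y` is a right multiple of `x`). -/
def LDvd (x y : M) : Prop := ∃ z, x * z = y

/-- `x` is a right divisor of `y` (and `y` is a left multiple of `x`). -/
def RDvd (x y : M) : Prop := ∃ z, z * x = y

/-- `z` is a right lcm of `x` and `y`. -/
def IsRightLcm (x y z : M) : Prop :=
  LDvd x z ∧ LDvd y z ∧ ∀ m, LDvd x m → LDvd y m → LDvd z m

/-- `z` is a left lcm of `x` and `y`. -/
def IsLeftLcm (x y z : M) : Prop :=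
  RDvd x z ∧ RDvd y z ∧ ∀ m, RDvd x m → RDvd y m → RDvd z m

/-- `z` is a left gcd of `x` and `y`. -/
def IsLeftGcd (x y z : M) : Prop :=
  LDvd z x ∧ LDvd z y ∧ ∀ d, LDvd d x → LDvd d y → LDvd d z

/-- `z` is a right gcd of `x` and `y`. -/
def IsRightGcd (x y z : M) : Prop :=
  RDvd z x ∧ RDvd z y ∧ ∀ d, RDvd d x → RDvd d y → RDvd d z

/-- `z` is the right complement `x \ y`, i.e. `x * z` is the right lcm of `x` and `y`. -/
def IsRightCompl (x y z : M) : Prop := IsRightLcm x y (x * z)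

/-- `z` is a right lcm of the set `X`. -/
def IsRightLcmOfSet (X : Set M) (z : M) : Prop :=
  (∀ x ∈ X, LDvd x z) ∧ ∀ m, (∀ x ∈ X, LDvd x m) → LDvd z m

/-- Atoms: the elements `x ≠ 1` such that `x = y * z` implies `y = 1` or `z = 1`. -/
def IsAtomElt (x : M) : Prop := x ≠ 1 ∧ ∀ y z, x = y * z → y = 1 ∨ z = 1

/-- Garside elements: left and right divisors coincide, are finitely many, and generate. -/
structure IsGarsideElement (Δ : M) : Prop where
  divisors_eq : {x : M | LDvd x Δ} = {x : M | RDvd x Δ}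
  finite_divisors : {x : M | LDvd x Δ}.Finite
  generate : Submonoid.closure {x : M | LDvd x Δ} = ⊤

/-- Simple elements: the closure of the atoms under right complement and right lcm. -/
inductive IsSimple : M → Prop
  | atom {x : M} : IsAtomElt x → IsSimple x
  | compl {x y z : M} : IsSimple x → IsSimple y → IsRightCompl x y z → IsSimple z
  | lcm {x y z : M} : IsSimple x → IsSimple y → IsRightLcm x y z → IsSimple z

/-- For `Δ` the right lcm of the simple elements and `x` simple: `x^* ∧ y = 1`, where
`x^* = x \ Δ` and `∧` is the left gcd. -/
def StarCoprime (Δ x y : M) : Prop := ∃ c, IsRightCompl x Δ c ∧ IsLeftGcd c y 1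

end Divisibility

section Monoids

variable (M : Type*) [Monoid M]

/-- Atomic monoids: generated by the atoms, and for each `x` the lengths of the decompositions
of `x` into atoms are bounded. -/
structure IsAtomicMonoid : Prop where
  generate : Submonoid.closure {x : M | IsAtomElt x} = ⊤
  bounded : ∀ x : M, ∃ N : ℕ, ∀ l : List M, (∀ a ∈ l, IsAtomElt a) → l.prod = x → l.length ≤ N

/-- Gaussian monoids. -/
structure IsGaussianMonoid : Prop where
  atomic : IsAtomicMonoid M
  cancel : IsCancelMul M
  right_lcm : ∀ x y : M, ∃ z, IsRightLcm x y z
  left_lcm : ∀ x y : M, ∃ z, IsLeftLcm x y z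
  right_gcd : ∀ x y : M, ∃ z, IsRightGcd x y z
  left_gcd : ∀ x y : M, ∃ z, IsLeftGcd x y z

/-- Garside monoids: Gaussian monoids that contain a Garside element. -/
structure IsGarsideMonoid : Prop where
  gaussian : IsGaussianMonoid M
  garside : ∃ Δ : M, IsGarsideElement Δ

/-- The type of simple elements. -/
abbrev Simples : Type _ := {x : M // IsSimple x}

/-- Letters: `Sum.inl s` stands for `s`, and `Sum.inr s` for `s⁻¹`, with `s` simple. -/
abbrev Letter : Type _ := Simples M ⊕ Simples M

end Monoids

/-- `ι : M → G` makes `G` the group of fractions of `M`: it is an embedding, and every element of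
`G` is a fraction `x⁻¹ y` with `x`, `y` in `M`. -/
structure IsGroupOfFractions {M G : Type*} [Monoid M] [Group G] (ι : M →* G) : Prop where
  injective : Function.Injective ι
  fraction : ∀ g : G, ∃ x y : M, g = (ι x)⁻¹ * ι y

/-- The element of `G` that a letter represents. -/
def letterVal {M G : Type*} [Monoid M] [Group G] (ι : M →* G) : Letter M → G :=
  Sum.elim (fun s => ι s.1) (fun s => (ι s.1)⁻¹)

/-- `(x₁, …, x_p)` consists of simple elements different from `1` with `x_k^* ∧ x_{k+1} = 1`. -/
def IsNormalSeq {M : Type*} [Monoid M] (Δ : M) (l : List (Simples M)) : Prop :=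
  (∀ s ∈ l, s.1 ≠ 1) ∧ l.IsChain (fun s t => StarCoprime Δ s.1 t.1)

/-- The language of left normal forms: the words `x_p⁻¹ ⋯ x₁⁻¹ y₁ ⋯ y_q` with `(x₁, …, x_p)` and
`(y₁, …, y_q)` normal sequences, and with `x₁ ∧ y₁ = 1` if `p, q ≥ 1`. -/
def leftNormalForms {M : Type*} [Monoid M] (Δ : M) : Language (Letter M) :=
  {w | ∃ xs ys : List (Simples M), IsNormalSeq Δ xs ∧ IsNormalSeq Δ ys ∧
    (∀ x ∈ xs.head?, ∀ y ∈ ys.head?, IsLeftGcd x.1 y.1 1) ∧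
    w = xs.reverse.map Sum.inr ++ ys.map Sum.inl}

end Garside

namespace Automatic

variable {G A : Type*} [Group G]

/-- The element of `G` that a word represents. -/
def wordVal (ev : A → G) (w : List A) : G := (w.map ev).prod

/-- The pair `(u, v)` read synchronously, the shorter word being padded at its end (by `none`). -/
def padPair (u v : List A) : List (Option A × Option A) := List.zipWithAll Prod.mk u v

/-- Padded pairs `(u, v)` of words of `L` with `v = u g` in `G`. -/
def rightMultiplier (ev : A → G) (L : Language A) (g : G) : Language (Option A × Option A) :=
  {p | ∃ u ∈ L, ∃ v ∈ L, wordVal ev v = wordVal ev u * g ∧ p = padPair u v}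

/-- Padded pairs `(u, v)` of words of `L` with `v = g u` in `G`. -/
def leftMultiplier (ev : A → G) (L : Language A) (g : G) : Language (Option A × Option A) :=
  {p | ∃ u ∈ L, ∃ v ∈ L, wordVal ev v = g * wordVal ev u ∧ p = padPair u v}

/-- `L` is the language of a biautomatic structure on `G` over the finite alphabet `A`, closed
under inversion: `L` is regular, every element of `G` is represented by a word of `L`, and the
equality relation and the right and left multiplications by letters are recognized by finite
automata that read two words of `L` synchronously. -/
structure IsBiautomaticStructure (ev : A → G) (L : Language A) : Prop where
  finite_alphabet : Finite A
  inv_closed : ∀ a, ∃ b, ev b = (ev a)⁻¹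
  regular : L.IsRegular
  surjective : ∀ g : G, ∃ w ∈ L, wordVal ev w = g
  equality : (rightMultiplier ev L 1).IsRegular
  right_mul : ∀ a, (rightMultiplier ev L (ev a)).IsRegular
  left_mul : ∀ a, (leftMultiplier ev L (ev a)).IsRegular

/-- `G` is biautomatic: it has a biautomatic structure over some finite alphabet. -/
def IsBiautomaticGroup (G : Type*) [Group G] : Prop :=
  ∃ (n : ℕ) (ev : Fin n → G) (L : Language (Fin n)), IsBiautomaticStructure ev L

/-- The element `g` is represented by a word of length at most `k`. -/
def LengthLE (ev : A → G) (k : ℕ) (g : G) : Prop := ∃ w : List A, w.length ≤ k ∧ wordVal ev w = g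

/-- The word distance from `g` to `h` is at most `k` (for an alphabet closed under inversion). -/
def DistLE (ev : A → G) (k : ℕ) (g h : G) : Prop := LengthLE ev k (g⁻¹ * h)

/-- The `k`-fellow-traveller property of `L` for right multiplication: if the end points of
`u, v ∈ L` are at distance at most `1`, so that `v = u g`, the paths of `u` and `v` from `1`
stay at distance at most `k`. -/
def RightFellowTraveller (ev : A → G) (L : Language A) (k : ℕ) : Prop :=
  ∀ u ∈ L, ∀ v ∈ L, ∀ g, LengthLE ev 1 g → wordVal ev v = wordVal ev u * g →
    ∀ t : ℕ, DistLE ev k (wordVal ev (u.take t)) (wordVal ev (v.take t))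

/-- The `k`-fellow-traveller property of `L` for left multiplication: if `u, v ∈ L` and `v = g u`
with `g` of length at most `1`, the path of `u` from `g` and the path of `v` from `1` stay at
distance at most `k`. -/
def LeftFellowTraveller (ev : A → G) (L : Language A) (k : ℕ) : Prop :=
  ∀ u ∈ L, ∀ v ∈ L, ∀ g, LengthLE ev 1 g → wordVal ev v = g * wordVal ev u →
    ∀ t : ℕ, DistLE ev k (g * wordVal ev (u.take t)) (wordVal ev (v.take t))

end Automatic

/-! Order `G` by `g ≤ h` iff `g⁻¹ * h ∈ M`. This order is invariant under left translations and has
binary meets (`IsGroupOfFractions.exists_semilatticeInf`). Every left divisor of `Δ` is also a right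
divisor and conversely, so `M` can be pushed through `Δ` in both directions; hence right
multiplication by `Δ` is an order automorphism (`IsSimpleLcm.isQuasiCentral`), and `(1, Δ]` is the
set of nontrivial simple elements.

Normal forms then have closed formulas. A greedy sequence with product `y` has prefix products `y ⊓
Δ ^ n`, and a mixed form of `g` has denominator `(g ⊓ 1)⁻¹`; this gives existence and uniqueness. If
`p` is the number of inverse letters, i.e. the least `n` with `1 ≤ g * Δ ^ n`, the path of `g` at
time `t` is `g * Δ ^ (p - t) ⊓ Δ ^ (t - p)` with truncated subtraction (`prod_take_mixedForm`).

Multiplying `g` on either side by `s ∈ [1, Δ]` lowers `p` by at most one. Monotonicity of the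
formula then keeps the two paths within one element of `[1, Δ]`: they fellow-travel with constant 1,
better than the required 2. The language itself is given by conditions on consecutive letters, hence
regular, and an automaton that remembers the bounded word difference recognizes the multipliers. -/

namespace Automatic

/-! ### Regularity from finitely many states -/

section Regular

variable {α : Type*}

/-- A language is regular if its nonempty left quotients are determined by finitely many values of
a state function. -/
theorem isRegular_of_finite_states {σ : Type*} {K : Language α} {T : Set σ} (hT : T.Finite)
    (f : List α → σ) (hmem : ∀ w z, w ++ z ∈ K → f w ∈ T)
    (hf : ∀ w w', f w = f w' → ∀ z, w ++ z ∈ K → w' ++ z ∈ K) : K.IsRegular := by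
  apply Language.IsRegular.of_finite_range_leftQuotient
  refine ((hT.image fun t => ({z | ∃ w, f w = t ∧ w ++ z ∈ K} : Language α)).insert
    (∅ : Set (List α))).subset ?_
  rintro _ ⟨w, rfl⟩
  by_cases h : ∃ z, w ++ z ∈ K
  · obtain ⟨z, hz⟩ := h
    refine Or.inr ⟨f w, hmem w z hz, ?_⟩
    ext y
    exact ⟨fun ⟨w', hw', hy⟩ => hf w' w hw' y hy, fun hy => ⟨w, rfl, hy⟩⟩
  · refine Or.inl (Set.eq_empty_of_forall_notMem fun z hz => h ⟨z, hz⟩)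

/-- The words whose letters satisfy `P` and whose consecutive letters are related by `R`. -/
def localLanguage (P : α → Prop) (R : α → α → Prop) : Language α :=
  {w | (∀ a ∈ w, P a) ∧ w.IsChain R}

theorem mem_localLanguage {P : α → Prop} {R : α → α → Prop} {w : List α} :
    w ∈ localLanguage P R ↔ (∀ a ∈ w, P a) ∧ w.IsChain R := Iff.rfl

/-- It suffices to remember whether the prefix is admissible and what its last letter is. -/
theorem isRegular_localLanguage [Finite α] (P : α → Prop) (R : α → α → Prop) :
    (localLanguage P R).IsRegular := by
  refine isRegular_of_finite_states (Set.toFinite Set.univ)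
    (fun w => (w ∈ localLanguage P R, w.getLast?)) (fun _ _ _ => Set.mem_univ _) ?_
  intro w w' h z hz
  simp only [Prod.mk.injEq, eq_iff_iff] at h
  obtain ⟨hP, hR⟩ := hz
  rw [List.isChain_append] at hR
  have hw' := h.1.1 ⟨fun a ha => hP a (by simp [ha]), hR.1⟩
  refine ⟨fun a ha => ?_, List.isChain_append.2 ⟨hw'.2, hR.2.1, h.2 ▸ hR.2.2⟩⟩
  rcases List.mem_append.1 ha with ha | ha
  · exact hw'.1 a ha
  · exact hP a (by simp [ha])

end Regular

/-! ### Synchronous reading of two words -/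

section Padding

variable {A : Type*}

/-- The words that are of the form `padPair u v`. -/
def paddedWords (A : Type*) : Language (Option A × Option A) :=
  localLanguage (fun a => a ≠ (none, none))
    (fun a b => (a.1 = none → b.1 = none) ∧ (a.2 = none → b.2 = none))

theorem filterMap_fst_padPair (u v : List A) : (padPair u v).filterMap Prod.fst = u := by
  induction u generalizing v with
  | nil => simp [padPair]
  | cons a u ih =>
    cases v with
    | nil => simp [padPair]
    | cons b v => simpa [padPair] using ih v

theorem filterMap_snd_padPair (u v : List A) : (padPair u v).filterMap Prod.snd = v := by
  induction u generalizing v with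
  | nil => simp [padPair]
  | cons a u ih =>
    cases v with
    | nil => simp [padPair]
    | cons b v => simpa [padPair] using ih v

theorem take_padPair (u v : List A) (t : ℕ) :
    (padPair u v).take t = padPair (u.take t) (v.take t) := by
  induction u generalizing v t with
  | nil => simp [padPair]
  | cons a u ih =>
    cases t with
    | zero => simp [padPair]
    | succ t =>
      cases v with
      | nil => simp [padPair]
      | cons b v => simpa [padPair] using ih v t

theorem padPair_mem_paddedWords (u v : List A) : padPair u v ∈ paddedWords A := by
  induction u generalizing v with
  | nil =>
    refine ⟨by simp [padPair], ?_⟩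
    simp only [padPair, List.nil_zipWithAll, List.isChain_map]
    exact (List.isChain_iff_getElem).2 (by simp)
  | cons a u ih =>
    cases v with
    | nil =>
      refine ⟨by simp [padPair], ?_⟩
      simp only [padPair, List.zipWithAll_nil, List.isChain_map]
      exact (List.isChain_iff_getElem).2 (by simp)
    | cons b v =>
      refine ⟨?_, ?_⟩
      · have := (ih v).1
        simp only [padPair, List.zipWithAll_cons_cons, List.mem_cons]
        rintro x (rfl | hx)
        · simp
        · exact this x hx
      · simp only [padPair, List.zipWithAll_cons_cons, List.isChain_cons]
        exact ⟨by simp, (ih v).2⟩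

/-- A track that shows `none` once shows it forever, so deleting the padding loses nothing. -/
theorem eq_padPair_of_mem_paddedWords {w : List (Option A × Option A)} (h : w ∈ paddedWords A) :
    w = padPair (w.filterMap Prod.fst) (w.filterMap Prod.snd) := by
  induction w with
  | nil => rfl
  | cons a w ih =>
    obtain ⟨hP, hR⟩ := h
    rw [List.isChain_cons] at hR
    have ih := ih ⟨fun b hb => hP b (by simp [hb]), hR.2⟩
    have hnil : (a.1 = none → w.filterMap Prod.fst = []) ∧
        (a.2 = none → w.filterMap Prod.snd = []) := by
      have hh := hR.1
      rw [ih] at hh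
      clear ih hP hR
      generalize w.filterMap Prod.fst = u at hh ⊢
      generalize w.filterMap Prod.snd = v at hh ⊢
      constructor <;> intro h0 <;> cases u <;> cases v <;> simp_all [padPair]
    rcases a with ⟨_ | a, _ | b⟩
    · exact absurd rfl (hP _ (by simp))
    · have h1 := hnil.1 rfl
      rw [h1] at ih
      simp only [List.filterMap_cons, h1]
      rw [ih]
      simp [padPair]
    · have h1 := hnil.2 rfl
      rw [h1] at ih
      simp only [List.filterMap_cons, h1]
      rw [ih]
      simp [padPair]
    · simpa [padPair] using ih

end Padding

/-! ### Fellow travelling implies biautomaticity -/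

section FellowTraveller

variable {G A : Type*} [Group G] {ev : A → G} {L : Language A}

theorem wordVal_append (ev : A → G) (u v : List A) :
    wordVal ev (u ++ v) = wordVal ev u * wordVal ev v := by
  simp [wordVal]

theorem LengthLE.mono {k l : ℕ} {g : G} (hkl : k ≤ l) (h : LengthLE ev k g) : LengthLE ev l g :=
  let ⟨w, hw, hg⟩ := h
  ⟨w, hw.trans hkl, hg⟩

theorem finite_lengthLE [Finite A] (ev : A → G) (k : ℕ) : {g | LengthLE ev k g}.Finite := by
  refine ((List.finite_length_le A k).image (wordVal ev)).subset ?_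
  rintro g ⟨w, hw, rfl⟩
  exact ⟨w, hw, rfl⟩

/-- The multiplier language of the two-sided translation `u ↦ g u h` is regular as soon as the
corresponding paths stay at bounded distance. -/
theorem isRegular_multiplier [Finite A] (hL : L.IsRegular) (g h : G) (k : ℕ)
    (hft : ∀ u ∈ L, ∀ v ∈ L, wordVal ev v = g * wordVal ev u * h → ∀ t,
      DistLE ev k (g * wordVal ev (u.take t)) (wordVal ev (v.take t))) :
    Language.IsRegular ({p | ∃ u ∈ L, ∃ v ∈ L, wordVal ev v = g * wordVal ev u * h ∧
      p = padPair u v} : Language (Option A × Option A)) := by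
  set K : Language (Option A × Option A) :=
    {p | ∃ u ∈ L, ∃ v ∈ L, wordVal ev v = g * wordVal ev u * h ∧ p = padPair u v} with hK
  have hmem : ∀ p, p ∈ K ↔ p ∈ paddedWords A ∧ p.filterMap Prod.fst ∈ L ∧
      p.filterMap Prod.snd ∈ L ∧
      wordVal ev (p.filterMap Prod.snd) = g * wordVal ev (p.filterMap Prod.fst) * h := by
    intro p
    constructor
    · rintro ⟨u, hu, v, hv, huv, rfl⟩
      rw [filterMap_fst_padPair, filterMap_snd_padPair]
      exact ⟨padPair_mem_paddedWords u v, hu, hv, huv⟩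
    · rintro ⟨hp, hu, hv, huv⟩
      exact ⟨_, hu, _, hv, huv, eq_padPair_of_mem_paddedWords hp⟩
  have hpad := (isRegular_localLanguage (α := Option A × Option A) (fun a => a ≠ (none, none))
    (fun a b => (a.1 = none → b.1 = none) ∧ (a.2 = none → b.2 = none))).finite_range_leftQuotient
  -- The state consists of the left quotients for the padding and for both tracks, together with the
  -- word difference. Only prefixes that extend to a word of `K` need a state in the finite set; for
  -- these `hft` bounds the difference.
  refine isRegular_of_finite_states
    (hpad.prod (hL.finite_range_leftQuotient.prod (hL.finite_range_leftQuotient.prod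
      (finite_lengthLE ev k))))
    (fun w => ((paddedWords A).leftQuotient w, L.leftQuotient (w.filterMap Prod.fst),
      L.leftQuotient (w.filterMap Prod.snd),
      (g * wordVal ev (w.filterMap Prod.fst))⁻¹ * wordVal ev (w.filterMap Prod.snd))) ?_ ?_
  · rintro w z ⟨u, hu, v, hv, huv, hwz⟩
    refine ⟨⟨w, rfl⟩, ⟨_, rfl⟩, ⟨_, rfl⟩, ?_⟩
    have hw : w = padPair (u.take w.length) (v.take w.length) := by
      rw [← take_padPair, ← hwz, List.take_left]
    have h1 := congrArg (List.filterMap Prod.fst) hw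
    have h2 := congrArg (List.filterMap Prod.snd) hw
    rw [filterMap_fst_padPair] at h1
    rw [filterMap_snd_padPair] at h2
    simp only [h1, h2]
    exact hft u hu v hv huv _
  · intro w w' hww z hz
    simp only [Prod.mk.injEq] at hww
    obtain ⟨e1, e2, e3, e4⟩ := hww
    rw [hmem] at hz ⊢
    simp only [List.filterMap_append, wordVal_append] at hz ⊢
    obtain ⟨z1, z2, z3, z4⟩ := hz
    refine ⟨?_, ?_, ?_, ?_⟩
    · rw [← Language.mem_leftQuotient] at z1 ⊢
      rwa [← e1]
    · rw [← Language.mem_leftQuotient] at z2 ⊢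
      rwa [← e2]
    · rw [← Language.mem_leftQuotient] at z3 ⊢
      rwa [← e3]
    -- Rearranged so that the prefix enters the equation only through its word difference.
    · rw [← mul_assoc g, mul_assoc (g * _), ← inv_mul_eq_iff_eq_mul, ← mul_assoc] at z4 ⊢
      rw [← e4, z4]

/-- A regular language of representatives with the two fellow-traveller properties is the language
of a biautomatic structure. -/
theorem IsBiautomaticStructure.of_fellowTraveller [Finite A] {k : ℕ}
    (hinv : ∀ a, ∃ b, ev b = (ev a)⁻¹) (hL : L.IsRegular)
    (hsurj : ∀ g : G, ∃ w ∈ L, wordVal ev w = g)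
    (hr : RightFellowTraveller ev L k) (hl : LeftFellowTraveller ev L k) :
    IsBiautomaticStructure ev L := by
  have hright : ∀ g, LengthLE ev 1 g → (rightMultiplier ev L g).IsRegular := by
    intro g hg
    have := isRegular_multiplier (ev := ev) hL 1 g k (by
      intro u hu v hv huv t
      rw [one_mul] at huv ⊢
      exact hr u hu v hv g hg huv t)
    simp only [one_mul] at this
    exact this
  have hleft : ∀ g, LengthLE ev 1 g → (leftMultiplier ev L g).IsRegular := by
    intro g hg
    have := isRegular_multiplier (ev := ev) hL g 1 k (by
      intro u hu v hv huv t
      rw [mul_one] at huv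
      exact hl u hu v hv g hg huv t)
    simp only [mul_one] at this
    exact this
  have hletter : ∀ a, LengthLE ev 1 (ev a) := fun a => ⟨[a], by simp, by simp [wordVal]⟩
  exact ⟨inferInstance, hinv, hL, hsurj, hright 1 ⟨[], by simp, rfl⟩,
    fun a => hright _ (hletter a), fun a => hleft _ (hletter a)⟩

theorem lengthLE_comp_equiv {B : Type*} (e : B ≃ A) (ev : A → G) (k : ℕ) (g : G) :
    LengthLE (ev ∘ e) k g ↔ LengthLE ev k g := by
  constructor
  · rintro ⟨w, hw, rfl⟩
    exact ⟨w.map e, by simpa using hw, by simp [wordVal]⟩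
  · rintro ⟨w, hw, rfl⟩
    exact ⟨w.map e.symm, by simpa using hw, by simp [wordVal, Function.comp_def]⟩

/-- A regular language of representatives with the two fellow-traveller properties makes the group
biautomatic. -/
theorem isBiautomaticGroup_of_fellowTraveller [Finite A] {k : ℕ}
    (hinv : ∀ a, ∃ b, ev b = (ev a)⁻¹) (hL : L.IsRegular)
    (hsurj : ∀ g : G, ∃ w ∈ L, wordVal ev w = g)
    (hr : RightFellowTraveller ev L k) (hl : LeftFellowTraveller ev L k) :
    IsBiautomaticGroup G := by
  obtain ⟨n, ⟨e'⟩⟩ := Finite.exists_equiv_fin A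
  let e := e'.symm
  have hval : ∀ w, wordVal (ev ∘ e) w = wordVal ev (w.map e) := by simp [wordVal]
  let L' : Language (Fin n) := List.map e ⁻¹' L
  have hmem : ∀ w, w ∈ L' ↔ w.map e ∈ L := fun w => Iff.rfl
  refine ⟨n, ev ∘ e, L', IsBiautomaticStructure.of_fellowTraveller (k := k) ?_ ?_ ?_ ?_ ?_⟩
  · intro a
    obtain ⟨b, hb⟩ := hinv (e a)
    exact ⟨e.symm b, by simpa using hb⟩
  · obtain ⟨σ, i, D, rfl⟩ := hL
    exact ⟨σ, i, D.comap e, D.accepts_comap e⟩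
  · intro g
    obtain ⟨w, hw, hg⟩ := hsurj g
    have hmap : (w.map e.symm).map e = w := by simp
    exact ⟨w.map e.symm, by rwa [hmem, hmap], by rwa [hval, hmap]⟩
  · intro u hu v hv g hg huv t
    rw [hval, hval] at huv
    rw [DistLE, lengthLE_comp_equiv, hval, hval, List.map_take, List.map_take]
    exact hr _ hu _ hv g ((lengthLE_comp_equiv e ev 1 g).1 hg) huv t
  · intro u hu v hv g hg huv t
    rw [hval, hval] at huv
    rw [DistLE, lengthLE_comp_equiv, hval, hval, List.map_take, List.map_take]
    exact hl _ hu _ hv g ((lengthLE_comp_equiv e ev 1 g).1 hg) huv t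

end FellowTraveller

end Automatic

namespace Garside

/-! ### Normal forms in a left-ordered group with a quasi-central element -/

section OrderedGroup

variable {G : Type*} [Group G] [SemilatticeInf G]

/-- In a left-ordered group: the element `D` is positive, right multiplication by `D` is an order
automorphism, and the powers of `D` are cofinal. -/
structure IsQuasiCentral (D : G) : Prop where
  one_le : 1 ≤ D
  mul_le_mul : ∀ a b, a * D ≤ b * D ↔ a ≤ b
  cofinal : ∀ a, 1 ≤ a → ∃ n : ℕ, a ≤ D ^ n

namespace IsQuasiCentral

variable {D : G} (hD : IsQuasiCentral D)
include hD

theorem mul_pow_le_mul_pow (n : ℕ) (a b : G) : a * D ^ n ≤ b * D ^ n ↔ a ≤ b := by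
  induction n with
  | zero => simp
  | succ n ih => rw [pow_succ, ← mul_assoc, ← mul_assoc, hD.mul_le_mul, ih]

theorem mul_pow_le_pow_succ {s : G} (hs : s ≤ D) (n : ℕ) : s * D ^ n ≤ D ^ (n + 1) := by
  rw [pow_succ', hD.mul_pow_le_mul_pow]
  exact hs

theorem pow_le_mul_pow {s : G} (hs : 1 ≤ s) (n : ℕ) : D ^ n ≤ s * D ^ n := by
  have := (hD.mul_pow_le_mul_pow n 1 s).2 hs
  rwa [one_mul] at this

theorem inf_mul_pow (n : ℕ) (a b : G) : (a ⊓ b) * D ^ n = a * D ^ n ⊓ b * D ^ n := by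
  let e : G ≃o G := ⟨Equiv.mulRight (D ^ n), by intro a b; exact hD.mul_pow_le_mul_pow n a b⟩
  exact e.map_inf a b

theorem inf_mul (a b : G) : (a ⊓ b) * D = a * D ⊓ b * D := by
  simpa using hD.inf_mul_pow 1 a b

end IsQuasiCentral

/-- Greedy sequences: sequences of elements of `(1, D]` such that each term is the largest lower
bound of `D` and of the product of itself with the next term. -/
def IsGreedy (D : G) (l : List G) : Prop :=
  (∀ s ∈ l, 1 ≤ s ∧ s ≤ D ∧ s ≠ 1) ∧ l.IsChain (fun s t => s * t ⊓ D = s)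

theorem IsGreedy.tail {D s : G} {l : List G} (h : IsGreedy D (s :: l)) : IsGreedy D l :=
  ⟨fun t ht => h.1 t (by simp [ht]), (List.isChain_cons.1 h.2).2⟩

theorem IsGreedy.drop {D : G} {l : List G} (h : IsGreedy D l) (n : ℕ) : IsGreedy D (l.drop n) :=
  ⟨fun t ht => h.1 t (List.mem_of_mem_drop ht), h.2.drop n⟩

/-- The elements `a` and `b` differ by right multiplication by an element of `[1, D]`. -/
def IsClose (D a b : G) : Prop := a ≤ b ∧ b ≤ a * D ∨ b ≤ a ∧ a ≤ b * D

theorem IsClose.symm {D a b : G} (h : IsClose D a b) : IsClose D b a := Or.symm h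

variable [MulLeftMono G]

theorem mul_left_inf (c a b : G) : c * (a ⊓ b) = c * a ⊓ c * b :=
  (OrderIso.mulLeft c).map_inf a b

theorem one_le_inv_mul_iff {a b : G} : 1 ≤ a⁻¹ * b ↔ a ≤ b := by
  rw [← mul_le_mul_iff_left a, mul_one, mul_inv_cancel_left]

namespace IsQuasiCentral

variable {D : G} (hD : IsQuasiCentral D)
include hD

theorem one_le_pow (n : ℕ) : 1 ≤ D ^ n := by
  induction n with
  | zero => simp
  | succ n ih => exact ih.trans (by rw [pow_succ]; exact le_mul_of_one_le_right' hD.one_le)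

theorem le_mul_pow (a : G) (n : ℕ) : a ≤ a * D ^ n := le_mul_of_one_le_right' (hD.one_le_pow n)

/-- Since `y ≤ y * D ^ n`, meeting with `y * D ^ n` as well changes nothing. This peels off the
first greedy factor `y ⊓ D`. -/
theorem inf_pow_succ {y : G} (n : ℕ) : y ⊓ D ^ (n + 1) = y ⊓ (y ⊓ D) * D ^ n := by
  rw [hD.inf_mul_pow, ← inf_assoc, inf_eq_left.2 (hD.le_mul_pow y n), pow_succ']

end IsQuasiCentral

theorem IsGreedy.one_le_prod {D : G} {l : List G} (h : IsGreedy D l) : 1 ≤ l.prod := by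
  induction l with
  | nil => simp
  | cons s l ih =>
    rw [List.prod_cons]
    exact one_le_mul (h.1 s (by simp)).1 (ih h.tail)

namespace IsQuasiCentral

variable {D : G} (hD : IsQuasiCentral D)
include hD

/-- As `D ≤ s * D`, the tail matters only through its meet with `D`, which by induction is its own
head `t`; then `s * t ⊓ D = s` is the local condition. -/
theorem prod_inf_eq_head {s : G} {l : List G} (h : IsGreedy D (s :: l)) :
    (s :: l).prod ⊓ D = s := by
  induction l generalizing s with
  | nil => simpa using (h.1 s (by simp)).2.1
  | cons t l ih =>
    have hs := (h.1 s (by simp)).1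
    have hle : D ≤ s * D := by
      have := (hD.mul_le_mul 1 s).2 hs
      rwa [one_mul] at this
    have hst : s * t ⊓ D = s := (List.isChain_cons.1 h.2).1 t (by simp)
    rw [List.prod_cons, ← inf_eq_right.2 hle, ← inf_assoc, ← mul_left_inf, ih h.tail, hst]

theorem prod_inf_pow {l : List G} (h : IsGreedy D l) (n : ℕ) :
    l.prod ⊓ D ^ n = (l.take n).prod := by
  induction n generalizing l with
  | zero => simpa using h.one_le_prod
  | succ n ih =>
    cases l with
    | nil => simpa using hD.one_le_pow (n + 1)
    | cons s l =>
      rw [hD.inf_pow_succ, hD.prod_inf_eq_head h, List.prod_cons, ← mul_left_inf, ih h.tail,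
        List.take_succ_cons, List.prod_cons]

theorem eq_nil_of_prod_eq_one {l : List G} (h : IsGreedy D l) (h1 : l.prod = 1) : l = [] := by
  cases l with
  | nil => rfl
  | cons s l =>
    have := hD.prod_inf_eq_head h
    rw [h1, inf_eq_left.2 hD.one_le] at this
    exact absurd this.symm (h.1 s (by simp)).2.2

theorem greedy_injective {l l' : List G} (h : IsGreedy D l) (h' : IsGreedy D l')
    (hp : l.prod = l'.prod) : l = l' := by
  induction l generalizing l' with
  | nil => exact (hD.eq_nil_of_prod_eq_one h' (by simpa using hp.symm)).symm
  | cons s l ih =>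
    cases l' with
    | nil => exact hD.eq_nil_of_prod_eq_one h (by simpa using hp)
    | cons s' l' =>
      have hs : s = s' := by rw [← hD.prod_inf_eq_head h, hp, hD.prod_inf_eq_head h']
      subst hs
      rw [ih h.tail h'.tail (by simpa using hp)]

theorem exists_greedy {y : G} (hy : 1 ≤ y) : ∃ l, IsGreedy D l ∧ l.prod = y := by
  obtain ⟨n, hn⟩ := hD.cofinal y hy
  induction n generalizing y with
  | zero => exact ⟨[], ⟨by simp, by simp⟩, (le_antisymm (by simpa using hn) hy).symm⟩
  | succ n ih =>
    set s := y ⊓ D with hs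
    have hs1 : 1 ≤ s := le_inf hy hD.one_le
    have hyn : s⁻¹ * y ≤ D ^ n := by
      have h := hD.inf_pow_succ (y := y) n
      rw [inf_eq_left.2 hn, ← hs] at h
      rw [← mul_le_mul_iff_left s, mul_inv_cancel_left]
      exact inf_eq_left.1 h.symm
    obtain ⟨l, hl, hly⟩ := ih (one_le_inv_mul_iff.2 inf_le_left) hyn
    -- Greedy terms must differ from 1; a trivial `s` is dropped without changing the product.
    by_cases h1 : s = 1
    · exact ⟨l, hl, by rw [hly, ← hs, h1, inv_one, one_mul]⟩
    · refine ⟨s :: l, ⟨?_, ?_⟩, by rw [List.prod_cons, hly, ← hs, mul_inv_cancel_left]⟩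
      · rintro t (_ | ⟨_, ht⟩)
        · exact ⟨hs1, inf_le_right, h1⟩
        · exact hl.1 t ht
      · refine List.isChain_cons.2 ⟨?_, hl.2⟩
        intro t ht
        cases l with
        | nil => simp at ht
        | cons t' l =>
          obtain rfl : t' = t := by simpa using ht
          apply le_antisymm
          -- `s * t'` is a prefix of `y`, so its meet with `D` is at most `y ⊓ D = s`.
          · refine le_inf (inf_le_left.trans ?_) inf_le_right
            rw [← mul_inv_cancel_left s y, ← hly, List.prod_cons, mul_le_mul_iff_left]
            exact le_mul_of_one_le_right' hl.tail.one_le_prod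
          · exact le_inf (le_mul_of_one_le_right' (hl.1 t' (by simp)).1) inf_le_right

/-- The meet of the two products, met with `D`, is the meet of the heads; and a positive element
whose meet with `D` is 1 has an empty greedy sequence. -/
theorem prod_inf_prod_eq_one_iff {xs ys : List G} (hx : IsGreedy D xs) (hy : IsGreedy D ys) :
    xs.prod ⊓ ys.prod = 1 ↔ ∀ x ∈ xs.head?, ∀ y ∈ ys.head?, x ⊓ y = 1 := by
  rcases xs with _ | ⟨x, xs⟩
  · simpa using hy.one_le_prod
  rcases ys with _ | ⟨y, ys⟩
  · simpa using hx.one_le_prod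
  have key : ((x :: xs).prod ⊓ (y :: ys).prod) ⊓ D = x ⊓ y := by
    rw [inf_inf_distrib_right, hD.prod_inf_eq_head hx, hD.prod_inf_eq_head hy]
  constructor
  · intro h
    rw [h, inf_eq_left.2 hD.one_le] at key
    simpa using key.symm
  · intro h
    have hxy : x ⊓ y = 1 := h x (by simp) y (by simp)
    rw [hxy] at key
    obtain ⟨l, hl, hlz⟩ := hD.exists_greedy (le_inf hx.one_le_prod hy.one_le_prod)
    rw [← hlz] at key ⊢
    cases l with
    | nil => rfl
    | cons z l =>
      rw [hD.prod_inf_eq_head hl] at key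
      exact absurd key (hl.1 z (by simp)).2.2

end IsQuasiCentral

/-- Pairs of greedy sequences whose first terms are coprime; they represent the fraction
`xs.prod⁻¹ * ys.prod`. -/
structure IsMixedForm (D : G) (xs ys : List G) : Prop where
  left : IsGreedy D xs
  right : IsGreedy D ys
  coprime : ∀ x ∈ xs.head?, ∀ y ∈ ys.head?, x ⊓ y = 1

namespace IsQuasiCentral

variable {D : G} (hD : IsQuasiCentral D)
include hD

/-- Coprimality translated by `xs.prod⁻¹`. The denominator is thereby determined by the fraction
alone. -/
theorem inf_one_of_mixedForm {xs ys : List G} (h : IsMixedForm D xs ys) :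
    xs.prod⁻¹ * ys.prod ⊓ 1 = xs.prod⁻¹ := by
  have h1 := (hD.prod_inf_prod_eq_one_iff h.left h.right).2 h.coprime
  have h2 := congrArg (xs.prod⁻¹ * ·) h1
  simp only [mul_left_inf, inv_mul_cancel, mul_one] at h2
  rwa [inf_comm]

theorem mixedForm_injective {xs ys xs' ys' : List G} (h : IsMixedForm D xs ys)
    (h' : IsMixedForm D xs' ys') (he : xs.prod⁻¹ * ys.prod = xs'.prod⁻¹ * ys'.prod) :
    xs = xs' ∧ ys = ys' := by
  have hx : xs.prod = xs'.prod := by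
    rw [← inv_inj, ← hD.inf_one_of_mixedForm h, ← hD.inf_one_of_mixedForm h', he]
  rw [hx] at he
  exact ⟨hD.greedy_injective h.left h'.left hx,
    hD.greedy_injective h.right h'.right (mul_left_cancel he)⟩

theorem exists_mixedForm (g : G) :
    ∃ xs ys, IsMixedForm D xs ys ∧ xs.prod⁻¹ * ys.prod = g := by
  set x := (g ⊓ 1)⁻¹ with hx
  have hx1 : 1 ≤ x := by
    simp [hx]
  have hy1 : 1 ≤ x * g := one_le_inv_mul_iff.2 inf_le_left
  obtain ⟨xs, hxs, hxp⟩ := hD.exists_greedy hx1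
  obtain ⟨ys, hys, hyp⟩ := hD.exists_greedy hy1
  refine ⟨xs, ys, ⟨hxs, hys, (hD.prod_inf_prod_eq_one_iff hxs hys).1 ?_⟩, by simp [hxp, hyp]⟩
  rw [hxp, hyp]
  calc x ⊓ x * g = x * (g ⊓ 1) := by rw [mul_left_inf, mul_one, inf_comm]
    _ = 1 := by simp [hx]

/-- With `g` the fraction and `x` its denominator, `g ⊓ 1 = x⁻¹`, so `g * D ^ n` is positive iff `x
≤ D ^ n`, i.e. iff the first `n` greedy terms already exhaust `x`. -/
theorem length_le_iff {xs ys : List G} (h : IsMixedForm D xs ys) (n : ℕ) :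
    xs.length ≤ n ↔ 1 ≤ xs.prod⁻¹ * ys.prod * D ^ n := by
  have h1 : 1 ≤ xs.prod⁻¹ * ys.prod * D ^ n ↔ xs.prod ≤ D ^ n := by
    rw [← one_le_inv_mul_iff (a := xs.prod), ← hD.inf_one_of_mixedForm h, hD.inf_mul_pow,
      le_inf_iff, one_mul, hD.inf_one_of_mixedForm h]
    exact (and_iff_left (hD.one_le_pow n)).symm
  rw [h1, ← inf_eq_left (a := xs.prod), hD.prod_inf_pow h.left]
  constructor
  · intro hn
    rw [List.take_of_length_le hn]
  · intro hn
    rw [← List.drop_eq_nil_iff]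
    apply hD.eq_nil_of_prod_eq_one (h.left.drop n)
    have := List.prod_take_mul_prod_drop xs n
    rw [hn] at this
    exact mul_eq_left.1 this

end IsQuasiCentral

/-- The point at time `t` of the path from `1` to `g` that is described by the mixed form of `g`,
where `p` is the number of inverses in the mixed form. -/
def mixedPath (D : G) (p : ℕ) (g : G) (t : ℕ) : G := g * D ^ (p - t) ⊓ D ^ (t - p)

namespace IsQuasiCentral

variable {D : G} (hD : IsQuasiCentral D)
include hD

/-- Let `g = x⁻¹ * y`. Up to time `p` the prefix is `x⁻¹ * (x ⊓ D ^ (p - t))`, afterwards `x⁻¹ * (y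
⊓ D ^ (t - p))`. Distributing and substituting `x⁻¹ = g ⊓ 1` gives the formula in both cases. -/
theorem prod_take_mixedForm {xs ys : List G} (h : IsMixedForm D xs ys) (t : ℕ) :
    ((xs.reverse.map (·⁻¹) ++ ys).take t).prod =
      mixedPath D xs.length (xs.prod⁻¹ * ys.prod) t := by
  have h1 := hD.inf_one_of_mixedForm h
  rw [mixedPath, List.take_append, List.prod_append, List.length_map, List.length_reverse,
    ← hD.prod_inf_pow h.right]
  rcases le_total t xs.length with ht | ht
  · have hd : ((xs.reverse.map (·⁻¹)).take t).prod = xs.prod⁻¹ * (xs.take (xs.length - t)).prod := by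
      rw [← List.map_take, List.take_reverse, List.map_reverse, ← List.prod_inv_reverse,
        inv_mul_eq_iff_eq_mul.2]
      rw [eq_mul_inv_iff_mul_eq, List.prod_take_mul_prod_drop]
    rw [hd, Nat.sub_eq_zero_of_le ht, pow_zero, inf_eq_right.2 h.right.one_le_prod, mul_one,
      ← hD.prod_inf_pow h.left, mul_left_inf, inv_mul_cancel, ← h1, hD.inf_mul_pow, h1, one_mul,
      inf_comm, inf_assoc, inf_eq_right.2 (hD.one_le_pow _)]
  · rw [List.take_of_length_le (by simpa using ht), Nat.sub_eq_zero_of_le ht, pow_zero, mul_one,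
      List.map_reverse, ← List.prod_inv_reverse, mul_left_inf]
    nth_rw 2 [← h1]
    rw [hD.inf_mul_pow, one_mul, ← inf_assoc, inf_eq_left.2 (hD.le_mul_pow _ _)]

end IsQuasiCentral

theorem IsClose.mul_left {D a b : G} (h : IsClose D a b) (c : G) : IsClose D (c * a) (c * b) := by
  simpa [IsClose, mul_assoc] using h

namespace IsQuasiCentral

variable {D : G} (hD : IsQuasiCentral D)
include hD

theorem pow_le_pow {m n : ℕ} (h : m ≤ n) : D ^ m ≤ D ^ n := by
  obtain ⟨k, rfl⟩ := Nat.exists_eq_add_of_le h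
  rw [pow_add]
  exact hD.le_mul_pow _ _

/-- Both meets are compared factor by factor, using `g * D ^ n ≤ g * s * D ^ n ≤ g * D ^ (n + 1)`.
-/
theorem isClose_mixedPath_mul_right {g s : G} (hs : 1 ≤ s) (hsD : s ≤ D) {p p' : ℕ}
    (hpp : p' = p ∨ p' + 1 = p) (t : ℕ) :
    IsClose D (mixedPath D p g t) (mixedPath D p' (g * s) t) := by
  have lo : ∀ n, g * D ^ n ≤ g * s * D ^ n := fun n => by
    rw [mul_assoc, mul_le_mul_iff_left]
    exact hD.pow_le_mul_pow hs n
  have hi : ∀ n, g * s * D ^ n ≤ g * D ^ (n + 1) := fun n => by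
    rw [mul_assoc, mul_le_mul_iff_left]
    exact hD.mul_pow_le_pow_succ hsD n
  simp only [IsClose, mixedPath, hD.inf_mul, mul_assoc _ _ D, ← pow_succ]
  rcases hpp with rfl | rfl
  · exact Or.inl ⟨inf_le_inf_right _ (lo _), inf_le_inf (hi _) (hD.pow_le_pow (by omega))⟩
  -- When `p` drops by one, the new path lies below the old one for `t ≤ p'` and above it from `t =
  -- p' + 1` on.
  · rcases lt_or_ge t (p' + 1) with ht | ht
    · have e1 : p' + 1 - t = p' - t + 1 := by omega
      have e2 : t - (p' + 1) = 0 := by omega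
      have e3 : t - p' = 0 := by omega
      rw [e1, e2, e3]
      exact Or.inr ⟨inf_le_inf_right _ (hi _), inf_le_inf (lo _) (hD.pow_le_pow (by omega))⟩
    · have e1 : p' + 1 - t = 0 := by omega
      have e2 : p' - t = 0 := by omega
      have e3 : t - p' = t - (p' + 1) + 1 := by omega
      rw [e1, e2, e3]
      exact Or.inl ⟨inf_le_inf (lo _) (hD.pow_le_pow (by omega)), inf_le_inf_right _ (hi _)⟩

/-- Here the factors `s * g * D ^ n` coincide up to the exponent, and the others are compared by `D
^ n ≤ s * D ^ n ≤ D ^ (n + 1)`. -/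
theorem isClose_mixedPath_mul_left {g s : G} (hs : 1 ≤ s) (hsD : s ≤ D) {p p' : ℕ}
    (hpp : p' = p ∨ p' + 1 = p) (t : ℕ) :
    IsClose D (s * mixedPath D p g t) (mixedPath D p' (s * g) t) := by
  have mono : ∀ {m n : ℕ}, m ≤ n → s * g * D ^ m ≤ s * g * D ^ n := fun h =>
    mul_le_mul_right (hD.pow_le_pow h) _
  have lo := hD.pow_le_mul_pow hs
  have hi := hD.mul_pow_le_pow_succ hsD
  simp only [IsClose, mixedPath, hD.inf_mul, mul_left_inf, mul_assoc _ _ D, ← pow_succ,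
    ← mul_assoc s g]
  rcases hpp with rfl | rfl
  · exact Or.inr ⟨inf_le_inf_left _ (lo _), inf_le_inf (mono (by omega)) (hi _)⟩
  · rcases lt_or_ge t (p' + 1) with ht | ht
    · have e2 : t - (p' + 1) = 0 := by omega
      have e3 : t - p' = 0 := by omega
      rw [e2, e3]
      exact Or.inr ⟨inf_le_inf (mono (by omega)) (lo _), inf_le_inf (mono (by omega)) (hi _)⟩
    · have e3 : t - p' = t - (p' + 1) + 1 := by omega
      rw [e3]
      exact Or.inl ⟨inf_le_inf (mono (by omega)) (hi _), inf_le_inf (mono (by omega)) (lo _)⟩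

theorem length_mul_right {xs ys xs' ys' : List G} (h : IsMixedForm D xs ys)
    (h' : IsMixedForm D xs' ys') {s : G} (hs : 1 ≤ s) (hsD : s ≤ D)
    (he : xs'.prod⁻¹ * ys'.prod = xs.prod⁻¹ * ys.prod * s) :
    xs'.length = xs.length ∨ xs'.length + 1 = xs.length := by
  have h1 : xs'.length ≤ xs.length := by
    rw [hD.length_le_iff h', he, mul_assoc]
    exact ((hD.length_le_iff h _).1 le_rfl).trans (mul_le_mul_right (hD.pow_le_mul_pow hs _) _)
  have h2 : xs.length ≤ xs'.length + 1 := by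
    have := (hD.length_le_iff h' _).1 le_rfl
    rw [he, mul_assoc] at this
    rw [hD.length_le_iff h]
    exact this.trans (mul_le_mul_right (hD.mul_pow_le_pow_succ hsD _) _)
  omega

theorem length_mul_left {xs ys xs' ys' : List G} (h : IsMixedForm D xs ys)
    (h' : IsMixedForm D xs' ys') {s : G} (hs : 1 ≤ s) (hsD : s ≤ D)
    (he : xs'.prod⁻¹ * ys'.prod = s * (xs.prod⁻¹ * ys.prod)) :
    xs'.length = xs.length ∨ xs'.length + 1 = xs.length := by
  have h1 : xs'.length ≤ xs.length := by
    rw [hD.length_le_iff h', he, mul_assoc]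
    exact one_le_mul hs ((hD.length_le_iff h _).1 le_rfl)
  have h2 : xs.length ≤ xs'.length + 1 := by
    have h3 := (hD.length_le_iff h' _).1 le_rfl
    rw [he] at h3
    -- One more `D` absorbs `s ≤ D`; cancelling `s` then leaves positivity.
    have h4 : s ≤ s * (xs.prod⁻¹ * ys.prod * D ^ (xs'.length + 1)) := by
      calc s ≤ 1 * D := by rwa [one_mul]
        _ ≤ s * (xs.prod⁻¹ * ys.prod) * D ^ xs'.length * D := (hD.mul_le_mul _ _).2 h3
        _ = _ := by rw [pow_succ]; simp only [mul_assoc]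
    rw [hD.length_le_iff h]
    exact (le_mul_iff_one_le_right' s).1 h4
  omega

end IsQuasiCentral

end OrderedGroup

end Garside

namespace Garside

/-! ### Simple elements of a Garside monoid -/

section Monoid

variable {M : Type*} [Monoid M]

theorem LDvd.refl (x : M) : LDvd x x := ⟨1, mul_one x⟩

theorem LDvd.trans {x y z : M} : LDvd x y → LDvd y z → LDvd x z := by
  rintro ⟨a, rfl⟩ ⟨b, rfl⟩
  exact ⟨a * b, (mul_assoc _ _ _).symm⟩

theorem one_lDvd (x : M) : LDvd 1 x := ⟨x, one_mul x⟩

theorem IsAtomicMonoid.exists_atoms (hM : IsAtomicMonoid M) (x : M) :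
    ∃ l : List M, (∀ a ∈ l, IsAtomElt a) ∧ l.prod = x := by
  have hx : x ∈ Submonoid.closure {x : M | IsAtomElt x} := by rw [hM.generate]; trivial
  exact Submonoid.exists_list_of_mem_closure hx

theorem IsAtomicMonoid.eq_one_of_mul_eq_one (hM : IsAtomicMonoid M) {x y : M} (h : x * y = 1) :
    x = 1 ∧ y = 1 := by
  obtain ⟨lx, hlx, rfl⟩ := hM.exists_atoms x
  obtain ⟨ly, hly, rfl⟩ := hM.exists_atoms y
  obtain ⟨N, hN⟩ := hM.bounded 1
  set l := lx ++ ly with hl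
  -- Powers of a nonempty atom word for 1 would be arbitrarily long decompositions of 1.
  have hlen := hN (List.replicate (N + 1) l).flatten (by
    intro a ha
    obtain ⟨l', hl', ha⟩ := List.mem_flatten.1 ha
    rw [List.eq_of_mem_replicate hl', hl] at ha
    rcases List.mem_append.1 ha with ha | ha
    · exact hlx a ha
    · exact hly a ha) (by
    rw [List.prod_flatten, List.map_replicate, List.prod_replicate, hl, List.prod_append, h,
      one_pow])
  have h0 : l.length = 0 := by
    by_contra h0
    rw [List.length_flatten, List.map_replicate, List.sum_replicate, smul_eq_mul] at hlen
    have := Nat.le_mul_of_pos_right (N + 1) (Nat.pos_of_ne_zero h0)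
    omega
  have h1 : lx = [] ∧ ly = [] := List.append_eq_nil_iff.1 (List.eq_nil_of_length_eq_zero h0)
  simp [h1]

theorem IsGaussianMonoid.lDvd_antisymm (hM : IsGaussianMonoid M) {x y : M} (h : LDvd x y)
    (h' : LDvd y x) : x = y := by
  have := hM.cancel
  obtain ⟨a, rfl⟩ := h
  obtain ⟨b, hb⟩ := h'
  rw [mul_assoc] at hb
  have := hM.atomic.eq_one_of_mul_eq_one (mul_eq_left.1 hb)
  rw [this.1, mul_one]

/-- Being simple or trivial; the difference matters for the trivial monoid only. -/
def IsSimpleOrOne (x : M) : Prop := x = 1 ∨ IsSimple x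

theorem IsSimpleOrOne.of_mul_left (hM : IsGaussianMonoid M) (y : M) {z : M}
    (h : IsSimpleOrOne (y * z)) : IsSimpleOrOne z := by
  have hy : y ∈ Submonoid.closure {x : M | IsAtomElt x} := by rw [hM.atomic.generate]; trivial
  induction hy using Submonoid.closure_induction generalizing z with
  | one => rwa [one_mul] at h
  | mem a ha =>
    rcases h with h | h
    · exact Or.inl (hM.atomic.eq_one_of_mul_eq_one h).2
    · exact Or.inr (.compl (.atom ha) h ⟨⟨z, rfl⟩, LDvd.refl _, fun m _ hm => hm⟩)
  | mul x y _ _ hx hy =>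
    rw [mul_assoc] at h
    exact hy (hx h)

theorem IsSimpleOrOne.rightLcm (hM : IsGaussianMonoid M) {x y z : M} (hx : IsSimpleOrOne x)
    (hy : IsSimpleOrOne y) (h : IsRightLcm x y z) : IsSimpleOrOne z := by
  rcases hx with rfl | hx
  · rwa [hM.lDvd_antisymm (h.2.2 y (one_lDvd y) (LDvd.refl y)) h.2.1]
  rcases hy with rfl | hy
  · rw [hM.lDvd_antisymm (h.2.2 x (LDvd.refl x) (one_lDvd x)) h.1]
    exact Or.inr hx
  · exact Or.inr (.lcm hx hy h)

theorem IsGarsideElement.lDvd_of_atom {D : M} (hD : IsGarsideElement D) {a : M}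
    (ha : IsAtomElt a) : LDvd a D := by
  have hmem : a ∈ Submonoid.closure {x : M | LDvd x D} := by rw [hD.generate]; trivial
  induction hmem using Submonoid.closure_induction with
  | mem x hx => exact hx
  | one => exact absurd rfl ha.1
  | mul x y _ _ hx hy =>
    rcases ha.2 x y rfl with rfl | rfl
    · rw [one_mul] at ha ⊢
      exact hy ha
    · rw [mul_one] at ha ⊢
      exact hx ha

/-- For complements: `x * z` divides `D` on the left, hence on the right; so does its right factor
`z`, which is then a left divisor again. -/
theorem IsGarsideElement.lDvd_of_isSimple {D : M} (hD : IsGarsideElement D) {x : M}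
    (hx : IsSimple x) : LDvd x D := by
  induction hx with
  | atom ha => exact hD.lDvd_of_atom ha
  | @compl x y z _ _ h hx hy =>
    have h1 : x * z ∈ {x : M | LDvd x D} := h.2.2 D hx hy
    have h2 : z ∈ {x : M | RDvd x D} := by
      rw [hD.divisors_eq] at h1
      obtain ⟨c, hc⟩ := h1
      exact ⟨c * x, by rw [mul_assoc, hc]⟩
    rwa [← hD.divisors_eq] at h2
  | lcm _ _ h hx hy => exact h.2.2 D hx hy

/-- The right lcm of the simple elements, together with the description of its divisors. -/
structure IsSimpleLcm (D : M) : Prop where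
  isRightLcmOfSet : IsRightLcmOfSet {x : M | IsSimple x} D
  lDvd_iff : ∀ x, LDvd x D ↔ IsSimpleOrOne x
  rDvd_iff : ∀ x, RDvd x D ↔ IsSimpleOrOne x
  finite : {x : M | IsSimple x}.Finite

theorem IsGarsideMonoid.exists_isSimpleLcm (hM : IsGarsideMonoid M) :
    ∃ D : M, IsSimpleLcm D := by
  have hG := hM.gaussian
  have := hG.cancel
  obtain ⟨E, hE⟩ := hM.garside
  have hsub : {x : M | IsSimpleOrOne x} ⊆ {x | LDvd x E} := by
    rintro x (rfl | hx)
    · exact one_lDvd E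
    · exact hE.lDvd_of_isSimple hx
  have hfin : {x : M | IsSimpleOrOne x}.Finite := hE.finite_divisors.subset hsub
  have hmax : ∀ F : Finset M, (∀ x ∈ F, IsSimpleOrOne x) →
      ∃ D, IsSimpleOrOne D ∧ ∀ x ∈ F, LDvd x D := by
    classical
    intro F
    induction F using Finset.induction_on with
    | empty => exact fun _ => ⟨1, Or.inl rfl, by simp⟩
    | insert a F _ ih =>
      intro hF
      obtain ⟨d, hd, hdF⟩ := ih fun x hx => hF x (by simp [hx])
      obtain ⟨e, he⟩ := hG.right_lcm a d
      refine ⟨e, IsSimpleOrOne.rightLcm hG (hF a (by simp)) hd he, fun x hx => ?_⟩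
      rcases Finset.mem_insert.1 hx with rfl | hx
      · exact he.1
      · exact (hdF x hx).trans he.2.1
  obtain ⟨D, hD, hDmax⟩ := hmax hfin.toFinset (by simp)
  have hDmax : ∀ x, IsSimpleOrOne x → LDvd x D := fun x hx => hDmax x (by simpa using hx)
  have hR : ∀ x, RDvd x D → IsSimpleOrOne x := by
    rintro x ⟨y, rfl⟩
    exact hD.of_mul_left hG y
  have hLfin : {x : M | LDvd x D}.Finite :=
    hE.finite_divisors.subset fun x hx => LDvd.trans hx (hsub hD)
  -- Right divisors of `D` are simple or 1, hence left divisors. Equality follows by counting: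
  -- sending a left divisor to its cofactor in `D` is injective into the right divisors.
  have heq : {x : M | RDvd x D} = {x | LDvd x D} := by
    refine Set.eq_of_subset_of_ncard_le (fun x hx => hDmax x (hR x hx)) ?_ hLfin
    choose! f hf using fun (x : M) (hx : LDvd x D) => hx
    refine Set.ncard_le_ncard_of_injOn f (fun x hx => ⟨x, hf x hx⟩) ?_
      (hfin.subset fun x hx => hR x hx)
    intro x hx y hy hxy
    have h := (hf x hx).trans (hf y hy).symm
    rw [hxy] at h
    exact mul_right_cancel h
  have heq' : ∀ x, RDvd x D ↔ LDvd x D := fun x => Set.ext_iff.1 heq x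
  refine ⟨D, ⟨fun x hx => hDmax x (Or.inr hx), ?_⟩, ?_, ?_, hfin.subset fun x hx => Or.inr hx⟩
  · intro m hm
    rcases hD with rfl | hD
    · exact one_lDvd m
    · exact hm D hD
  · exact fun x => ⟨fun h => hR x ((heq' x).2 h), hDmax x⟩
  · exact fun x => ⟨hR x, fun h => (heq' x).2 (hDmax x h)⟩

namespace IsSimpleLcm

variable {D : M} (hD : IsSimpleLcm D) (hM : IsAtomicMonoid M)
include hD

theorem rDvd_of_lDvd {x : M} (h : LDvd x D) : RDvd x D := (hD.rDvd_iff x).2 ((hD.lDvd_iff x).1 h)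

theorem lDvd_of_rDvd {x : M} (h : RDvd x D) : LDvd x D := (hD.lDvd_iff x).2 ((hD.rDvd_iff x).1 h)

include hM

/-- For an atom `a`, `D = a * b = b * c`, so `a * D = a * b * c = D * c`. -/
theorem exists_mul_eq (m : M) : ∃ m', m * D = D * m' := by
  have hm : m ∈ Submonoid.closure {x : M | IsAtomElt x} := by rw [hM.generate]; trivial
  induction hm using Submonoid.closure_induction with
  | mem a ha =>
    obtain ⟨b, hb⟩ := (hD.lDvd_iff a).2 (Or.inr (.atom ha))
    obtain ⟨c, hc⟩ := hD.lDvd_of_rDvd ⟨a, hb⟩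
    exact ⟨c, by rw [← hc, ← mul_assoc, hb, hc]⟩
  | one => exact ⟨1, by simp⟩
  | mul x y _ _ hx hy =>
    obtain ⟨x', hx⟩ := hx
    obtain ⟨y', hy⟩ := hy
    exact ⟨x' * y', by rw [mul_assoc, hy, ← mul_assoc, hx, mul_assoc]⟩

theorem exists_eq_mul (m : M) : ∃ m', D * m = m' * D := by
  have hm : m ∈ Submonoid.closure {x : M | IsAtomElt x} := by rw [hM.generate]; trivial
  induction hm using Submonoid.closure_induction with
  | mem a ha =>
    obtain ⟨b, hb⟩ := (hD.rDvd_iff a).2 (Or.inr (.atom ha))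
    obtain ⟨c, hc⟩ := hD.rDvd_of_lDvd ⟨a, hb⟩
    exact ⟨c, by rw [← hc, mul_assoc, hb, hc]⟩
  | one => exact ⟨1, by simp⟩
  | mul x y _ _ hx hy =>
    obtain ⟨x', hx⟩ := hx
    obtain ⟨y', hy⟩ := hy
    exact ⟨x' * y', by rw [← mul_assoc, hx, mul_assoc, hy, mul_assoc]⟩

theorem exists_mul_pow_eq (n : ℕ) (m : M) : ∃ m', m * D ^ n = D ^ n * m' := by
  induction n with
  | zero => exact ⟨m, by simp⟩
  | succ n ih =>
    obtain ⟨a, ha⟩ := ih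
    obtain ⟨b, hb⟩ := hD.exists_mul_eq hM a
    exact ⟨b, by rw [pow_succ, ← mul_assoc, ha, mul_assoc, hb, mul_assoc]⟩

theorem exists_lDvd_pow (m : M) : ∃ n : ℕ, LDvd m (D ^ n) := by
  obtain ⟨l, hl, rfl⟩ := hM.exists_atoms m
  induction l with
  | nil => exact ⟨0, one_lDvd _⟩
  | cons a l ih =>
    obtain ⟨n, c, hc⟩ := ih fun b hb => hl b (by simp [hb])
    obtain ⟨b, hb⟩ := (hD.lDvd_iff a).2 (Or.inr (.atom (hl a (by simp))))
    obtain ⟨b', hb'⟩ := hD.exists_mul_pow_eq hM n b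
    refine ⟨n + 1, c * b', ?_⟩
    calc (a :: l).prod * (c * b') = a * (l.prod * c * b') := by simp only [List.prod_cons, mul_assoc]
      _ = a * b * D ^ n := by rw [hc, ← hb', mul_assoc]
      _ = D ^ (n + 1) := by rw [hb, pow_succ']

end IsSimpleLcm

end Monoid

/-! ### The divisibility order on the group of fractions -/

section Fractions

variable {M G : Type*} [Monoid M] [Group G] {ι : M →* G}

/-- The group of fractions is an inf-semilattice for left divisibility. -/
theorem IsGroupOfFractions.exists_semilatticeInf (hι : IsGroupOfFractions ι)
    (hM : IsGaussianMonoid M) :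
    ∃ _ : SemilatticeInf G, ∀ g h : G, g ≤ h ↔ ∃ m, ι m = g⁻¹ * h := by
  have hinf : ∀ g h : G, ∃ d : G, (∃ m, ι m = d⁻¹ * g) ∧ (∃ m, ι m = d⁻¹ * h) ∧
      ∀ e : G, (∃ m, ι m = e⁻¹ * g) → (∃ m, ι m = e⁻¹ * h) → ∃ m, ι m = e⁻¹ * d := by
    intro g h
    have := hM.cancel
    obtain ⟨x₁, y₁, rfl⟩ := hι.fraction g
    obtain ⟨x₂, y₂, rfl⟩ := hι.fraction h
    -- A common denominator reduces the meet in `G` to a left gcd of numerators.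
    obtain ⟨x, ⟨a, ha⟩, ⟨b, hb⟩, -⟩ := hM.left_lcm x₁ x₂
    have e1 : (ι x₁)⁻¹ * ι y₁ = (ι x)⁻¹ * ι (a * y₁) := by simp [← ha, mul_assoc]
    have e2 : (ι x₂)⁻¹ * ι y₂ = (ι x)⁻¹ * ι (b * y₂) := by simp [← hb, mul_assoc]
    rw [e1, e2]
    generalize a * y₁ = u
    generalize b * y₂ = v
    obtain ⟨d, ⟨u', hu⟩, ⟨v', hv⟩, hd⟩ := hM.left_gcd u v
    refine ⟨(ι x)⁻¹ * ι d, ⟨u', by simp [← hu]⟩, ⟨v', by simp [← hv]⟩, ?_⟩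
    rintro e ⟨p, hp⟩ ⟨q, hq⟩
    obtain ⟨z, w, hzw⟩ := hι.fraction (ι x * e)
    have he : e⁻¹ = (ι w)⁻¹ * ι z * ι x := by
      rw [eq_comm, ← mul_left_inj e, mul_assoc, hzw]
      simp
    have hwu : w * p = z * u := hι.injective (by rw [map_mul, hp, he, map_mul]; group)
    have hwv : w * q = z * v := hι.injective (by rw [map_mul, hq, he, map_mul]; group)
    -- A lower bound `e` need not be of the form `x⁻¹ * m`. With `x * e = z⁻¹ * w`, `w` divides the
    -- gcd of `z * u` and `z * v`, which is `z * k` with `k` dividing `d`.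
    obtain ⟨f, ⟨f1, hf1⟩, ⟨f2, hf2⟩, hf⟩ := hM.left_gcd (z * u) (z * v)
    obtain ⟨k, rfl⟩ := hf z ⟨u, rfl⟩ ⟨v, rfl⟩
    have hk : LDvd k d := hd k ⟨f1, by rw [mul_assoc] at hf1; exact mul_left_cancel hf1⟩
      ⟨f2, by rw [mul_assoc] at hf2; exact mul_left_cancel hf2⟩
    obtain ⟨r, hr⟩ := hf w ⟨p, hwu⟩ ⟨q, hwv⟩
    obtain ⟨s, rfl⟩ := hk
    refine ⟨r * s, ?_⟩
    have hr' := congrArg ι hr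
    simp only [map_mul] at hr' ⊢
    rw [he, eq_inv_mul_iff_mul_eq.2 hr']
    group
  choose inf h1 h2 h3 using hinf
  exact ⟨{
    le := fun g h => ∃ m, ι m = g⁻¹ * h
    le_refl := fun g => ⟨1, by simp⟩
    le_trans := by
      rintro a b c ⟨m, hm⟩ ⟨n, hn⟩
      exact ⟨m * n, by rw [map_mul, hm, hn]; group⟩
    le_antisymm := by
      rintro a b ⟨m, hm⟩ ⟨n, hn⟩
      have : m * n = 1 := hι.injective (by rw [map_mul, hm, hn, map_one]; group)
      rw [(hM.atomic.eq_one_of_mul_eq_one this).1, map_one] at hm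
      exact (inv_mul_eq_one.1 hm.symm)
    inf := inf
    inf_le_left := h1
    inf_le_right := h2
    le_inf := fun a b c hb hc => h3 b c a hb hc }, fun _ _ => Iff.rfl⟩

variable [SemilatticeInf G] (hle : ∀ g h : G, g ≤ h ↔ ∃ m, ι m = g⁻¹ * h)
include hle

theorem mulLeftMono_of_le_iff : MulLeftMono G :=
  ⟨fun c a b h => by
    rw [hle] at h ⊢
    obtain ⟨m, hm⟩ := h
    exact ⟨m, by rw [hm]; group⟩⟩

theorem one_le_iff_mem_range {g : G} : 1 ≤ g ↔ ∃ m, ι m = g := by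
  rw [hle, inv_one, one_mul]

theorem map_le_map_iff (hι : IsGroupOfFractions ι) {x y : M} : ι x ≤ ι y ↔ LDvd x y := by
  rw [hle]
  constructor
  · rintro ⟨m, hm⟩
    exact ⟨m, hι.injective (by rw [map_mul, hm, mul_inv_cancel_left])⟩
  · rintro ⟨m, rfl⟩
    exact ⟨m, by simp⟩

/-- A meet of two elements of `M` is at least 1, so it lies in `M` and is the gcd there. -/
theorem isLeftGcd_iff (hι : IsGroupOfFractions ι) {x y z : M} :
    IsLeftGcd x y z ↔ ι x ⊓ ι y = ι z := by
  have hrev : ∀ {d : M}, ι x ⊓ ι y = ι d → IsLeftGcd x y d := by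
    intro d hd
    simp only [IsLeftGcd, ← map_le_map_iff hle hι, ← hd]
    exact ⟨inf_le_left, inf_le_right, fun e h1 h2 => le_inf h1 h2⟩
  refine ⟨fun h => ?_, hrev⟩
  obtain ⟨d, hd⟩ := (one_le_iff_mem_range hle).1
    (le_inf ((one_le_iff_mem_range hle).2 ⟨x, rfl⟩) ((one_le_iff_mem_range hle).2 ⟨y, rfl⟩))
  have hd' := hrev hd.symm
  rw [← hd]
  exact le_antisymm ((map_le_map_iff hle hι).2 (h.2.2 d hd'.1 hd'.2.1))
    ((map_le_map_iff hle hι).2 (hd'.2.2 z h.1 h.2.1))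

/-- As `x` divides `D`, the complement `c` satisfies `x * c = D`; translating `c ⊓ y = 1` by `x`
gives the greedy condition. -/
theorem starCoprime_iff (hι : IsGroupOfFractions ι) {D x y : M} (hx : LDvd x D) :
    StarCoprime D x y ↔ ι x * ι y ⊓ ι D = ι x := by
  have := mulLeftMono_of_le_iff hle
  have key : ∀ c, x * c = D → (IsLeftGcd c y 1 ↔ ι x * ι y ⊓ ι D = ι x) := by
    rintro c rfl
    rw [isLeftGcd_iff hle hι, map_one, map_mul, inf_comm, ← mul_left_inf, mul_eq_left]
  constructor
  · rintro ⟨c, hc, hcy⟩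
    refine (key c ?_).1 hcy
    apply hι.injective
    exact le_antisymm ((map_le_map_iff hle hι).2 (hc.2.2 D hx (LDvd.refl D)))
      ((map_le_map_iff hle hι).2 hc.2.1)
  · intro h
    obtain ⟨c, rfl⟩ := hx
    exact ⟨c, ⟨⟨c, rfl⟩, LDvd.refl _, fun m _ hm => hm⟩, (key c rfl).2 h⟩

theorem IsSimpleLcm.isQuasiCentral {D : M} (hD : IsSimpleLcm D) (hM : IsAtomicMonoid M) :
    IsQuasiCentral (ι D) where
  one_le := (one_le_iff_mem_range hle).2 ⟨D, rfl⟩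
  mul_le_mul a b := by
    rw [hle, hle]
    constructor
    · rintro ⟨m, hm⟩
      obtain ⟨m', hm'⟩ := hD.exists_eq_mul hM m
      refine ⟨m', ?_⟩
      have h := congrArg ι hm'
      rw [map_mul, map_mul, hm] at h
      rw [← mul_inv_eq_iff_eq_mul] at h
      rw [← h]
      group
    · rintro ⟨m, hm⟩
      obtain ⟨m', hm'⟩ := hD.exists_mul_eq hM m
      refine ⟨m', ?_⟩
      have h := congrArg ι hm'
      rw [map_mul, map_mul, hm] at h
      rw [← inv_mul_eq_iff_eq_mul] at h
      rw [← h]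
      group
  cofinal a ha := by
    obtain ⟨m, rfl⟩ := (one_le_iff_mem_range hle).1 ha
    obtain ⟨n, c, hc⟩ := hD.exists_lDvd_pow hM m
    exact ⟨n, (hle _ _).2 ⟨c, by rw [← map_pow, ← hc]; simp⟩⟩

end Fractions

end Garside

namespace Garside

/-! ### Left normal forms as a local language -/

section RegularForms

variable {M : Type*} [Monoid M]

/-- The condition on two consecutive letters of a left normal form. -/
def FormStep (D : M) : Letter M → Letter M → Prop
  | .inr x, .inr x' => StarCoprime D x'.1 x.1
  | .inr x, .inl y => IsLeftGcd x.1 y.1 1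
  | .inl y, .inl y' => StarCoprime D y.1 y'.1
  | .inl _, .inr _ => False

theorem exists_split_of_isChain_formStep {D : M} {w : List (Letter M)}
    (h : w.IsChain (FormStep D)) :
    ∃ xs ys : List (Simples M), w = xs.reverse.map Sum.inr ++ ys.map Sum.inl := by
  induction w with
  | nil => exact ⟨[], [], rfl⟩
  | cons a w ih =>
    rw [List.isChain_cons] at h
    obtain ⟨xs, ys, rfl⟩ := ih h.2
    rcases a with y | x
    · rcases List.eq_nil_or_concat xs with rfl | ⟨xs, x, rfl⟩
      · exact ⟨[], y :: ys, by simp⟩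
      · exact (h.1 (.inr x) (by simp)).elim
    · exact ⟨xs ++ [x], ys, by simp⟩

theorem leftNormalForms_eq_localLanguage (D : M) :
    leftNormalForms D = Automatic.localLanguage
      (fun a : Letter M => Sum.elim (fun s => s.1) (fun s => s.1) a ≠ (1 : M)) (FormStep D) := by
  have key : ∀ xs ys : List (Simples M), (IsNormalSeq D xs ∧ IsNormalSeq D ys ∧
      (∀ x ∈ xs.head?, ∀ y ∈ ys.head?, IsLeftGcd x.1 y.1 1)) ↔
      (xs.reverse.map Sum.inr ++ ys.map Sum.inl : List (Letter M)) ∈ Automatic.localLanguage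
        (fun a : Letter M => Sum.elim (fun s => s.1) (fun s => s.1) a ≠ (1 : M)) (FormStep D) := by
    intro xs ys
    simp only [Automatic.mem_localLanguage, List.isChain_append, List.isChain_map,
      List.isChain_reverse, List.map_reverse, List.getLast?_reverse, List.mem_append,
      List.mem_reverse, List.mem_map, or_imp, forall_and, forall_exists_index, and_imp,
      forall_apply_eq_imp_iff₂, Sum.elim_inl, Sum.elim_inr, List.head?_map, Option.mem_map,
      FormStep, IsNormalSeq]
    tauto
  ext w
  constructor
  · rintro ⟨xs, ys, hx, hy, hxy, rfl⟩
    exact (key xs ys).1 ⟨hx, hy, hxy⟩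
  · intro hw
    obtain ⟨xs, ys, rfl⟩ := exists_split_of_isChain_formStep hw.2
    obtain ⟨hx, hy, hxy⟩ := (key xs ys).2 hw
    exact ⟨xs, ys, hx, hy, hxy, rfl⟩

theorem isRegular_leftNormalForms [Finite (Simples M)] (D : M) :
    (leftNormalForms D).IsRegular := by
  rw [leftNormalForms_eq_localLanguage]
  exact Automatic.isRegular_localLanguage _ _

end RegularForms

/-! ### Transfer to words in the simple elements -/

section NormalForms

open Automatic

variable {M G : Type*} [Monoid M] [Group G] {ι : M →* G}

theorem map_letterVal (ι : M →* G) (xs ys : List (Simples M)) :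
    (xs.reverse.map Sum.inr ++ ys.map Sum.inl : List (Letter M)).map (letterVal ι) =
      (xs.map fun s => ι s.1).reverse.map (·⁻¹) ++ ys.map fun s => ι s.1 := by
  simp [letterVal, Function.comp_def]

theorem wordVal_reverse_append (ι : M →* G) (xs ys : List (Simples M)) :
    wordVal (letterVal ι) (xs.reverse.map Sum.inr ++ ys.map Sum.inl) =
      (xs.map fun s => ι s.1).prod⁻¹ * (ys.map fun s => ι s.1).prod := by
  rw [wordVal, map_letterVal, List.prod_append, List.map_reverse, ← List.prod_inv_reverse]

variable [SemilatticeInf G] (hle : ∀ g h : G, g ≤ h ↔ ∃ m, ι m = g⁻¹ * h)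
  (hι : IsGroupOfFractions ι) {D : M} (hD : IsSimpleLcm D)
include hle hι hD

theorem isNormalSeq_iff (l : List (Simples M)) :
    IsNormalSeq D l ↔ IsGreedy (ι D) (l.map fun s => ι s.1) := by
  have hdvd : ∀ s : Simples M, LDvd s.1 D := fun s => (hD.lDvd_iff _).2 (Or.inr s.2)
  have hrel : (fun s t : Simples M => StarCoprime D s.1 t.1) =
      fun s t : Simples M => ι s.1 * ι t.1 ⊓ ι D = ι s.1 := by
    funext s t
    exact propext (starCoprime_iff hle hι (hdvd s))
  rw [IsNormalSeq, IsGreedy, List.isChain_map, hrel, List.forall_mem_map]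
  refine and_congr_left fun _ => forall₂_congr fun s _ => ?_
  rw [and_iff_right ((one_le_iff_mem_range hle).2 ⟨s.1, rfl⟩),
    and_iff_right ((map_le_map_iff hle hι).2 (hdvd s)), ne_eq, ne_eq, map_eq_one_iff ι hι.injective]

theorem mem_leftNormalForms_iff {w : List (Letter M)} :
    w ∈ leftNormalForms D ↔ ∃ xs ys : List (Simples M),
      IsMixedForm (ι D) (xs.map fun s => ι s.1) (ys.map fun s => ι s.1) ∧
      w = xs.reverse.map Sum.inr ++ ys.map Sum.inl := by
  refine exists₂_congr fun xs ys => ?_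
  have hco : (∀ x ∈ xs.head?, ∀ y ∈ ys.head?, IsLeftGcd x.1 y.1 1) ↔
      ∀ x ∈ (xs.map fun s => ι s.1).head?, ∀ y ∈ (ys.map fun s => ι s.1).head?, x ⊓ y = 1 := by
    rcases xs with _ | ⟨x, xs⟩ <;> rcases ys with _ | ⟨y, ys⟩ <;> simp [isLeftGcd_iff hle hι]
  rw [isNormalSeq_iff hle hι hD, isNormalSeq_iff hle hι hD, hco]
  exact ⟨fun ⟨h1, h2, h3, h4⟩ => ⟨⟨h1, h2, h3⟩, h4⟩, fun ⟨⟨h1, h2, h3⟩, h4⟩ => ⟨h1, h2, h3, h4⟩⟩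

/-- The case `g = 1` is excluded because 1 is not simple in the trivial monoid, which has no atoms.
-/
theorem exists_simple_of_mem_interval {g : G} (h1 : 1 ≤ g) (hg : g ≤ ι D) (hne : g ≠ 1) :
    ∃ s : Simples M, ι s.1 = g := by
  obtain ⟨m, rfl⟩ := (one_le_iff_mem_range hle).1 h1
  rcases (hD.lDvd_iff m).1 ((map_le_map_iff hle hι).1 hg) with rfl | hm
  · exact absurd (map_one ι) hne
  · exact ⟨⟨m, hm⟩, rfl⟩

theorem exists_map_eq_of_isGreedy {l : List G} (h : IsGreedy (ι D) l) :
    ∃ xs : List (Simples M), (xs.map fun s => ι s.1) = l := by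
  have : l ∈ Set.range (List.map fun s : Simples M => ι s.1) := by
    rw [Set.range_list_map]
    intro s hs
    obtain ⟨h1, h2, h3⟩ := h.1 s hs
    exact exists_simple_of_mem_interval hle hι hD h1 h2 h3
  exact this

theorem IsClose.distLE {a b : G} (h : IsClose (ι D) a b) : DistLE (letterVal ι) 1 a b := by
  have := mulLeftMono_of_le_iff hle
  by_cases hab : a = b
  · exact ⟨[], by simp, by simp [hab, wordVal]⟩
  have key : ∀ {a b : G}, a ≠ b → a ≤ b → b ≤ a * ι D → ∃ s : Simples M, ι s.1 = a⁻¹ * b := by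
    intro a b hab h1 h2
    refine exists_simple_of_mem_interval hle hι hD (one_le_inv_mul_iff.2 h1) ?_ ?_
    · rwa [← mul_le_mul_iff_left a, mul_inv_cancel_left]
    · rwa [ne_eq, inv_mul_eq_one]
  rcases h with ⟨h1, h2⟩ | ⟨h1, h2⟩
  · obtain ⟨s, hs⟩ := key hab h1 h2
    exact ⟨[.inl s], by simp, by simp [wordVal, letterVal, hs]⟩
  · obtain ⟨s, hs⟩ := key (Ne.symm hab) h1 h2
    exact ⟨[.inr s], by simp, by simp [wordVal, letterVal, hs]⟩

theorem exists_of_lengthLE_one {g : G} (h : LengthLE (letterVal ι) 1 g) :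
    ∃ s : G, 1 ≤ s ∧ s ≤ ι D ∧ (g = s ∨ g = s⁻¹) := by
  have hs : ∀ s : Simples M, 1 ≤ ι s.1 ∧ ι s.1 ≤ ι D := fun s =>
    ⟨(one_le_iff_mem_range hle).2 ⟨s.1, rfl⟩,
      (map_le_map_iff hle hι).2 ((hD.lDvd_iff _).2 (Or.inr s.2))⟩
  obtain ⟨w, hw, rfl⟩ := h
  rcases w with _ | ⟨a, _ | ⟨b, w⟩⟩
  · exact ⟨1, le_rfl, (one_le_iff_mem_range hle).2 ⟨D, rfl⟩, Or.inl rfl⟩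
  · rcases a with s | s
    · exact ⟨ι s.1, (hs s).1, (hs s).2, Or.inl (by simp [wordVal, letterVal])⟩
    · exact ⟨ι s.1, (hs s).1, (hs s).2, Or.inr (by simp [wordVal, letterVal])⟩
  · simp at hw

variable (hM : IsAtomicMonoid M)
include hM

theorem existsUnique_leftNormalForm (g : G) :
    ∃! w : List (Letter M), w ∈ leftNormalForms D ∧ wordVal (letterVal ι) w = g := by
  have := mulLeftMono_of_le_iff hle
  have hQ := hD.isQuasiCentral hle hM
  have hinj : Function.Injective fun s : Simples M => ι s.1 :=
    hι.injective.comp Subtype.val_injective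
  apply existsUnique_of_exists_of_unique
  · obtain ⟨xs', ys', h, hg⟩ := hQ.exists_mixedForm g
    obtain ⟨xs, rfl⟩ := exists_map_eq_of_isGreedy hle hι hD h.left
    obtain ⟨ys, rfl⟩ := exists_map_eq_of_isGreedy hle hι hD h.right
    exact ⟨_, (mem_leftNormalForms_iff hle hι hD).2 ⟨xs, ys, h, rfl⟩, (wordVal_reverse_append ι xs ys).trans hg⟩
  · rintro w w' ⟨hw, rfl⟩ ⟨hw', he⟩
    obtain ⟨xs, ys, h, rfl⟩ := (mem_leftNormalForms_iff hle hι hD).1 hw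
    obtain ⟨xs', ys', h', rfl⟩ := (mem_leftNormalForms_iff hle hι hD).1 hw'
    rw [wordVal_reverse_append, wordVal_reverse_append] at he
    obtain ⟨hx, hy⟩ := hQ.mixedForm_injective h h' he.symm
    rw [List.map_injective_iff.2 hinj hx, List.map_injective_iff.2 hinj hy]

theorem exists_mixedPath {w : List (Letter M)} (hw : w ∈ leftNormalForms D) :
    ∃ xs ys : List G, IsMixedForm (ι D) xs ys ∧
      wordVal (letterVal ι) w = xs.prod⁻¹ * ys.prod ∧
      ∀ t, wordVal (letterVal ι) (w.take t) =
        mixedPath (ι D) xs.length (wordVal (letterVal ι) w) t := by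
  have := mulLeftMono_of_le_iff hle
  obtain ⟨xs, ys, h, rfl⟩ := (mem_leftNormalForms_iff hle hι hD).1 hw
  have hval := wordVal_reverse_append ι xs ys
  refine ⟨_, _, h, hval, fun t => ?_⟩
  rw [hval, ← (hD.isQuasiCentral hle hM).prod_take_mixedForm h, wordVal, List.map_take,
    map_letterVal]

/-- Left normal forms satisfy the fellow-traveller property on the right with constant `1`. -/
theorem rightFellowTraveller_leftNormalForms :
    RightFellowTraveller (letterVal ι) (leftNormalForms D) 1 := by
  have := mulLeftMono_of_le_iff hle
  have hQ := hD.isQuasiCentral hle hM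
  have key : ∀ u ∈ leftNormalForms D, ∀ v ∈ leftNormalForms D, ∀ s : G, 1 ≤ s → s ≤ ι D →
      wordVal (letterVal ι) v = wordVal (letterVal ι) u * s → ∀ t,
      IsClose (ι D) (wordVal (letterVal ι) (u.take t)) (wordVal (letterVal ι) (v.take t)) := by
    intro u hu v hv s hs hsD huv t
    obtain ⟨xs, ys, h, hval, hpath⟩ := exists_mixedPath hle hι hD hM hu
    obtain ⟨xs', ys', h', hval', hpath'⟩ := exists_mixedPath hle hι hD hM hv
    rw [hpath, hpath', huv]
    refine hQ.isClose_mixedPath_mul_right hs hsD (hQ.length_mul_right h h' hs hsD ?_) t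
    rw [← hval, ← hval', huv]
  intro u hu v hv g hg huv t
  obtain ⟨s, hs, hsD, rfl | rfl⟩ := exists_of_lengthLE_one hle hι hD hg
  · exact (key u hu v hv _ hs hsD huv t).distLE hle hι hD
  -- For `g = s⁻¹` the roles of `u` and `v` are exchanged.
  · exact (key v hv u hu s hs hsD (by simp [huv]) t).symm.distLE hle hι hD

/-- Left normal forms satisfy the fellow-traveller property on the left with constant `1`. -/
theorem leftFellowTraveller_leftNormalForms :
    LeftFellowTraveller (letterVal ι) (leftNormalForms D) 1 := by
  have := mulLeftMono_of_le_iff hle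
  have hQ := hD.isQuasiCentral hle hM
  have key : ∀ u ∈ leftNormalForms D, ∀ v ∈ leftNormalForms D, ∀ s : G, 1 ≤ s → s ≤ ι D →
      wordVal (letterVal ι) v = s * wordVal (letterVal ι) u → ∀ t,
      IsClose (ι D) (s * wordVal (letterVal ι) (u.take t))
        (wordVal (letterVal ι) (v.take t)) := by
    intro u hu v hv s hs hsD huv t
    obtain ⟨xs, ys, h, hval, hpath⟩ := exists_mixedPath hle hι hD hM hu
    obtain ⟨xs', ys', h', hval', hpath'⟩ := exists_mixedPath hle hι hD hM hv
    rw [hpath, hpath', huv]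
    refine hQ.isClose_mixedPath_mul_left hs hsD (hQ.length_mul_left h h' hs hsD ?_) t
    rw [← hval, ← hval', huv]
  intro u hu v hv g hg huv t
  obtain ⟨s, hs, hsD, rfl | rfl⟩ := exists_of_lengthLE_one hle hι hD hg
  · exact (key u hu v hv _ hs hsD huv t).distLE hle hι hD
  -- Here `u` represents `s` times `v`; the comparison is translated back by `s⁻¹`.
  · have h := (key v hv u hu s hs hsD (by simp [huv]) t).symm.mul_left s⁻¹
    rw [inv_mul_cancel_left] at h
    exact h.distLE hle hι hD

end NormalForms

end Garside

theorem mainTheorem1 {M : Type*} [Monoid M] (hM : Garside.IsGarsideMonoid M)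
    {G : Type*} [Group G] (ι : M →* G) (hι : Garside.IsGroupOfFractions ι) :
    Automatic.IsBiautomaticGroup G ∧
    ∃ Δ : M, Garside.IsRightLcmOfSet {x : M | Garside.IsSimple x} Δ ∧
      (∀ g : G, ∃! w : List (Garside.Letter M),
        w ∈ Garside.leftNormalForms Δ ∧ Automatic.wordVal (Garside.letterVal ι) w = g) ∧
      Automatic.IsBiautomaticStructure (Garside.letterVal ι) (Garside.leftNormalForms Δ) ∧
      Automatic.RightFellowTraveller (Garside.letterVal ι) (Garside.leftNormalForms Δ) 2 ∧
      Automatic.LeftFellowTraveller (Garside.letterVal ι) (Garside.leftNormalForms Δ) 2 := by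
  obtain ⟨_, hle⟩ := hι.exists_semilatticeInf hM.gaussian
  obtain ⟨Δ, hΔ⟩ := hM.exists_isSimpleLcm
  have hA := hM.gaussian.atomic
  have : Finite (Garside.Simples M) := hΔ.finite
  have hinv : ∀ a : Garside.Letter M,
      ∃ b, Garside.letterVal ι b = (Garside.letterVal ι a)⁻¹ := by
    rintro (s | s)
    · exact ⟨.inr s, rfl⟩
    · exact ⟨.inl s, by simp [Garside.letterVal]⟩
  have hreg := Garside.isRegular_leftNormalForms Δ
  have huniq := Garside.existsUnique_leftNormalForm hle hι hΔ hA
  have hsurj : ∀ g : G, ∃ w ∈ Garside.leftNormalForms Δ,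
      Automatic.wordVal (Garside.letterVal ι) w = g := fun g => (huniq g).exists
  have hr := Garside.rightFellowTraveller_leftNormalForms hle hι hΔ hA
  have hl := Garside.leftFellowTraveller_leftNormalForms hle hι hΔ hA
  exact ⟨Automatic.isBiautomaticGroup_of_fellowTraveller hinv hreg hsurj hr hl, Δ,
    hΔ.isRightLcmOfSet, huniq, .of_fellowTraveller hinv hreg hsurj hr hl,
    fun u hu v hv g hg huv t => (hr u hu v hv g hg huv t).mono one_le_two,
    fun u hu v hv g hg huv t => (hl u hu v hv g hg huv t).mono one_le_two⟩
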